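/- Let $(M,g)$ be a $3$-dimensional semi-Riemannian manifold ($g$ is a smooth symmetric nondegenerate bilinear form on $TM$ of constant index $s$, $1\le s\le 2$), and let $\xi$ be a lightlike Killing vector field on $M$: $\xi$ is smooth and nowhere zero, $g(\xi,\xi)=0$ and $\mathcal L_\xi g=0$. Let $\mathcal F$ be the foliation with tangent bundle $T(\mathcal F)=\mathbb R\xi$. A basic $k$-form is a smooth $k$-form $\omega$ on $M$ with $\xi\rfloor\omega=0$ and $\xi\rfloor d\omega=0$; $\Omega^k_B(\mathcal F)$ is the space of basic $k$-forms (so $\Omega^0_B(\mathcal F)=\{f\in C^\infty(M):\xi(f)=0\}$), and $H^k_B(\mathcal F)=H^k(\Omega^\bullet_B(\mathcal F),d)$ is the basic cohomology of $\mathcal F$. Suppose that $\xi$ is complemented, i.e. there are a screen distribution $S=S(T(\mathcal F)^\perp)$ (a smooth distribution complementary to $\mathrm{Rad}\,T(\mathcal F)=T(\mathcal F)\cap T(\mathcal F)^\perp=\mathbb R\xi$ in $T(\mathcal F)^\perp$) and nowhere zero smooth vector fields $W$, $N$ on $M$, invariant under $\xi$ ($[\xi,W]=[\xi,N]=0$),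 with $W\in S$ and $N\in ltr(T\mathcal F)$, where $ltr(T\mathcal F)_x$ is the line spanned by the vector $v\in S_x^\perp$ with $g(v,\xi_x)=1$ and $g(v,v)=0$, such that 1. $[W,N]=0$; 2. $W$ is spacelike, $g(W,W)>0$, and $g(\xi,N)=1$; 3. for every $f\in\Omega^0_B(\mathcal F)$ there are $a,b\in\Omega^0_B(\mathcal F)$ with $N(b)-W(a)=f$. Then $H^2_B(\mathcal F)=0$. -/

import Mathlib

open Set
open scoped Manifold ContDiff

noncomputable section

namespace LightlikeFlow

section Forms

variable {E : Type*} [NormedAddCommGroup E] [NormedSpace ℝ E]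
variable {M : Type*} [TopologicalSpace M] [ChartedSpace E M]

/-- A (not necessarily smooth) differential `k`-form on a manifold `M` modelled on `E`: a field of
alternating `k`-linear forms on the tangent spaces. -/
abbrev Form (E : Type*) [NormedAddCommGroup E] [NormedSpace ℝ E]
    (M : Type*) [TopologicalSpace M] [ChartedSpace E M] (k : ℕ) : Type _ :=
  ∀ x : M, (TangentSpace 𝓘(ℝ, E) x) [⋀^Fin k]→L[ℝ] ℝ

instance instAddCommGroupForm {k : ℕ} : AddCommGroup (Form E M k) := Pi.addCommGroup

instance instAddCommMonoidForm {k : ℕ} : AddCommMonoid (Form E M k) :=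
  instAddCommGroupForm.toAddCommMonoid

instance instModuleForm {k : ℕ} : Module ℝ (Form E M k) := Pi.module _ _ _

/-- The expression of a form in the preferred chart `φ` at `x₀`, i.e. its pullback under `φ⁻¹`.
It is meaningful on the (open) target of `φ`. -/
def chartForm {k : ℕ} (α : Form E M k) (x₀ : M) : E → E [⋀^Fin k]→L[ℝ] ℝ := fun y =>
  (α ((extChartAt 𝓘(ℝ, E) x₀).symm y)).compContinuousLinearMap
    (mfderiv 𝓘(ℝ, E) 𝓘(ℝ, E) (extChartAt 𝓘(ℝ, E) x₀).symm y)

/-- A form is smooth if its expressions in the charts are smooth. -/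
def IsSmoothForm {k : ℕ} (α : Form E M k) : Prop :=
  ∀ x₀ : M, ContDiffOn ℝ ∞ (chartForm α x₀) (extChartAt 𝓘(ℝ, E) x₀).target

/-- The exterior derivative of a form: at `x`, it is computed in the preferred chart at `x`. -/
def extD {k : ℕ} (α : Form E M k) : Form E M (k + 1) := fun x =>
  (extDeriv (chartForm α x) (extChartAt 𝓘(ℝ, E) x x)).compContinuousLinearMap
    (mfderiv 𝓘(ℝ, E) 𝓘(ℝ, E) (extChartAt 𝓘(ℝ, E) x) x)

theorem chartForm_add {k : ℕ} (α η : Form E M k) (x₀ : M) :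
    chartForm (α + η) x₀ = chartForm α x₀ + chartForm η x₀ := rfl

theorem chartForm_smul {k : ℕ} (c : ℝ) (α : Form E M k) (x₀ : M) :
    chartForm (c • α) x₀ = c • chartForm α x₀ := rfl

theorem chartForm_zero {k : ℕ} (x₀ : M) : chartForm (0 : Form E M k) x₀ = 0 := rfl

theorem IsSmoothForm.differentiableAt {k : ℕ} {α : Form E M k} (h : IsSmoothForm α) (x : M) :
    DifferentiableAt ℝ (chartForm α x) (extChartAt 𝓘(ℝ, E) x x) :=
  ((h x).contDiffAt ((isOpen_extChartAt_target x).mem_nhds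
    (mem_extChartAt_target x))).differentiableAt (by simp)

theorem extD_add {k : ℕ} {α η : Form E M k} (hα : IsSmoothForm α) (hη : IsSmoothForm η) :
    extD (α + η) = extD α + extD η := by
  funext x
  simp only [extD, chartForm_add]
  rw [extDeriv_add (hα.differentiableAt x) (hη.differentiableAt x)]
  rfl

theorem extD_smul {k : ℕ} (c : ℝ) (α : Form E M k) : extD (c • α) = c • extD α := by
  funext x
  simp only [extD, chartForm_smul]
  rw [extDeriv_smul]
  rfl

theorem extD_zero {k : ℕ} : extD (0 : Form E M k) = 0 := by
  simpa using extD_smul (0 : ℝ) (0 : Form E M k)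

/-- A field of subspaces of the tangent spaces. -/
abbrev Distribution (E : Type*) [NormedAddCommGroup E] [NormedSpace ℝ E]
    (M : Type*) [TopologicalSpace M] [ChartedSpace E M] : Type _ :=
  ∀ x : M, Submodule ℝ (TangentSpace 𝓘(ℝ, E) x)

/-- `X ⌋ α = 0` for every `X` in the distribution `D`: since `α` is alternating, this says that `α`
vanishes as soon as one of its arguments is in `D`. There is no condition on `0`-forms. -/
def Annihilates {k : ℕ} (D : Distribution E M) (α : Form E M k) : Prop :=
  ∀ (x : M) (v : Fin k → TangentSpace 𝓘(ℝ, E) x), (∃ i, v i ∈ D x) → α x v = 0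

/-- The space of basic `k`-forms of the foliation with tangent distribution `D`: the smooth forms
`α` with `X ⌋ α = 0` and `X ⌋ dα = 0` for every `X` in `D`. -/
def basicForms (D : Distribution E M) (k : ℕ) : Submodule ℝ (Form E M k) where
  carrier := {α | IsSmoothForm α ∧ Annihilates D α ∧ Annihilates D (extD α)}
  zero_mem' := by
    refine ⟨fun x₀ => ?_, fun x v _ => rfl, ?_⟩
    · rw [chartForm_zero]; exact contDiffOn_const
    · rw [extD_zero]; exact fun x v _ => rfl
  add_mem' := by
    rintro α η ⟨h1, h2, h3⟩ ⟨k1, k2, k3⟩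
    refine ⟨fun x₀ => ?_, fun x v hv => ?_, ?_⟩
    · rw [chartForm_add]; exact (h1 x₀).add (k1 x₀)
    · simp [h2 x v hv, k2 x v hv]
    · rw [extD_add h1 k1]; intro x v hv
      simp [h3 x v hv, k3 x v hv]
  smul_mem' := by
    rintro c α ⟨h1, h2, h3⟩
    refine ⟨fun x₀ => ?_, fun x v hv => ?_, ?_⟩
    · rw [chartForm_smul]; exact (h1 x₀).const_smul c
    · simp [h2 x v hv]
    · rw [extD_smul]; intro x v hv
      simp [h3 x v hv]

/-- The exterior derivative as a linear map on basic forms. -/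
def basicD (D : Distribution E M) (k : ℕ) : basicForms D k →ₗ[ℝ] Form E M (k + 1) where
  toFun α := extD α.1
  map_add' α η := extD_add α.2.1 η.2.1
  map_smul' c α := extD_smul c α.1

/-- The closed basic `k`-forms. -/
def basicCocycles (D : Distribution E M) (k : ℕ) : Submodule ℝ (Form E M k) :=
  (LinearMap.ker (basicD D k)).map (basicForms D k).subtype

/-- The differentials of basic `(k-1)`-forms (only `0` for `k = 0`). -/
def basicCoboundaries (D : Distribution E M) : ∀ k : ℕ, Submodule ℝ (Form E M k)
  | 0 => ⊥
  | k + 1 => LinearMap.range (basicD D k)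

/-- The basic cohomology `H^k_B`: closed basic `k`-forms modulo differentials of basic
`(k-1)`-forms. -/
abbrev BasicCohomology (D : Distribution E M) (k : ℕ) : Type _ :=
  basicCocycles D k ⧸ (basicCoboundaries D k).submoduleOf (basicCocycles D k)

/-- A basic function: a smooth function `f` on `M` with `X(f) = 0` for every `X` in `D`. -/
def IsBasicFunction (D : Distribution E M) (f : M → ℝ) : Prop :=
  ContMDiff 𝓘(ℝ, E) 𝓘(ℝ, ℝ) ∞ f ∧ ∀ x, ∀ v ∈ D x, mvfderiv 𝓘(ℝ, E) f x v = 0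

end Forms

section Fields

variable {E : Type*} [NormedAddCommGroup E] [NormedSpace ℝ E]
variable {M : Type*} [TopologicalSpace M] [ChartedSpace E M] [IsManifold 𝓘(ℝ, E) ∞ M]

/-- A vector field which is smooth on the set `U`. -/
def IsSmoothFieldOn (X : ∀ x : M, TangentSpace 𝓘(ℝ, E) x) (U : Set M) : Prop :=
  ContMDiffOn 𝓘(ℝ, E) 𝓘(ℝ, E).tangent ∞ (fun x => (⟨x, X x⟩ : TangentBundle 𝓘(ℝ, E) M)) U

/-- A smooth vector field on `M`. -/
def IsSmoothField (X : ∀ x : M, TangentSpace 𝓘(ℝ, E) x) : Prop :=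
  ContMDiff 𝓘(ℝ, E) 𝓘(ℝ, E).tangent ∞ (fun x => (⟨x, X x⟩ : TangentBundle 𝓘(ℝ, E) M))

/-- A smooth distribution (subbundle of the tangent bundle): around each point it has a smooth
local frame. -/
def IsSmoothDistribution (D : Distribution E M) : Prop :=
  ∀ x₀ : M, ∃ U : Set M, IsOpen U ∧ x₀ ∈ U ∧
    ∃ (r : ℕ) (X : Fin r → ∀ x : M, TangentSpace 𝓘(ℝ, E) x),
      (∀ i, IsSmoothFieldOn (X i) U) ∧
      ∀ x ∈ U, LinearIndependent ℝ (fun i => X i x) ∧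
        Submodule.span ℝ (Set.range fun i => X i x) = D x

/-- The line distribution `ℝ ξ` spanned by a vector field. -/
def lineDistribution (ξ : ∀ x : M, TangentSpace 𝓘(ℝ, E) x) : Distribution E M :=
  fun x => Submodule.span ℝ {ξ x}

end Fields

section Metric

/-- A semi-Riemannian metric on `M`: a smooth field of symmetric nondegenerate bilinear forms on the
tangent spaces of constant index `1 ≤ index ≤ dim M - 1`. The index is the largest dimension of a
subspace on which the form is negative definite. -/
structure SemiRiemannianMetric (E : Type*) [NormedAddCommGroup E] [NormedSpace ℝ E]
    (M : Type*) [TopologicalSpace M] [ChartedSpace E M] [IsManifold 𝓘(ℝ, E) ∞ M] where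
  /-- the bilinear form on each tangent space -/
  val (x : M) : TangentSpace 𝓘(ℝ, E) x →L[ℝ] TangentSpace 𝓘(ℝ, E) x →L[ℝ] ℝ
  /-- the index -/
  index : ℕ
  symm (x : M) (v w : TangentSpace 𝓘(ℝ, E) x) : val x v w = val x w v
  nondegenerate (x : M) (v : TangentSpace 𝓘(ℝ, E) x) (hv : ∀ w, val x v w = 0) : v = 0
  index_eq (x : M) : sigNeg (LinearMap.BilinMap.toQuadraticMap (val x).toLinearMap₁₂) = index
  one_le_index : 1 ≤ index
  index_lt : index < Module.finrank ℝ E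
  contMDiff : ContMDiff 𝓘(ℝ, E) (𝓘(ℝ, E).prod 𝓘(ℝ, E →L[ℝ] E →L[ℝ] ℝ)) ∞
    (fun x => Bundle.TotalSpace.mk' (E →L[ℝ] E →L[ℝ] ℝ)
      (E := fun x : M => TangentSpace 𝓘(ℝ, E) x →L[ℝ] TangentSpace 𝓘(ℝ, E) x →L[ℝ] ℝ) x (val x))

variable {E : Type*} [NormedAddCommGroup E] [NormedSpace ℝ E]
variable {M : Type*} [TopologicalSpace M] [ChartedSpace E M] [IsManifold 𝓘(ℝ, E) ∞ M]

/-- A lightlike vector field: nowhere zero and null. -/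
def IsLightlike (g : SemiRiemannianMetric E M) (ξ : ∀ x : M, TangentSpace 𝓘(ℝ, E) x) : Prop :=
  ∀ x, ξ x ≠ 0 ∧ g.val x (ξ x) (ξ x) = 0

/-- A Killing vector field: `L_ξ g = 0`, that is `ξ(g(X, Y)) = g([ξ, X], Y) + g(X, [ξ, Y])` for all
smooth vector fields `X`, `Y`. -/
def IsKilling (g : SemiRiemannianMetric E M) (ξ : ∀ x : M, TangentSpace 𝓘(ℝ, E) x) : Prop :=
  ∀ X Y : ∀ x : M, TangentSpace 𝓘(ℝ, E) x, IsSmoothField X → IsSmoothField Y → ∀ x,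
    mvfderiv 𝓘(ℝ, E) (fun y => g.val y (X y) (Y y)) x (ξ x) =
      g.val x (VectorField.mlieBracket 𝓘(ℝ, E) ξ X x) (Y x) +
        g.val x (X x) (VectorField.mlieBracket 𝓘(ℝ, E) ξ Y x)

/-- The orthogonal complement of a distribution. -/
def orth (g : SemiRiemannianMetric E M) (D : Distribution E M) : Distribution E M := fun x =>
  { carrier := {v | ∀ w ∈ D x, g.val x v w = 0}
    zero_mem' := fun w _ => by simp
    add_mem' := fun {a b} ha hb w hw => by simp [ha w hw, hb w hw]
    smul_mem' := fun c a ha w hw => by simp [ha w hw] }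

/-- The radical `Rad D = D ∩ D^⊥`. -/
def rad (g : SemiRiemannianMetric E M) (D : Distribution E M) : Distribution E M :=
  fun x => D x ⊓ orth g D x

/-- `S` is a screen distribution `S(D^⊥)`: a smooth complement of `Rad D` in `D^⊥`. -/
def IsScreen (g : SemiRiemannianMetric E M) (D S : Distribution E M) : Prop :=
  IsSmoothDistribution S ∧ ∀ x, S x ⊓ rad g D x = ⊥ ∧ S x ⊔ rad g D x = orth g D x

/-- The lightlike transversal bundle `ltr` of the flow of a lightlike field `ξ` with respect to the
screen `S`: it is spanned at `x` by the vector `v ∈ S^⊥` with `g(v, ξ) = 1` and `g(v, v) = 0`. -/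
def ltr (g : SemiRiemannianMetric E M) (ξ : ∀ x : M, TangentSpace 𝓘(ℝ, E) x)
    (S : Distribution E M) : Distribution E M := fun x =>
  Submodule.span ℝ {v | v ∈ orth g S x ∧ g.val x v (ξ x) = 1 ∧ g.val x v v = 0}

/-- `X` is invariant under the flow of `ξ`: `L_ξ X = [ξ, X] = 0`. -/
def IsInvariant (ξ X : ∀ x : M, TangentSpace 𝓘(ℝ, E) x) : Prop :=
  ∀ x, VectorField.mlieBracket 𝓘(ℝ, E) ξ X x = 0

/-- A lightlike Killing vector field `ξ`, with flow foliation `F`, `T(F) = ℝ ξ`, is complemented if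
there are a screen distribution `S = S(T(F)^⊥)` and nowhere zero smooth invariant vector fields `W`
in `S` and `N` in `ltr(T(F))` such that `[W, N] = 0`, `W` is spacelike, `g(ξ, N) = 1`, and every
basic function is of the form `N(b) - W(a)` with `a`, `b` basic functions. -/
def IsComplemented (g : SemiRiemannianMetric E M) (ξ : ∀ x : M, TangentSpace 𝓘(ℝ, E) x) : Prop :=
  ∃ (S : Distribution E M) (W N : ∀ x : M, TangentSpace 𝓘(ℝ, E) x),
    IsScreen g (lineDistribution ξ) S ∧
    IsSmoothField W ∧ IsSmoothField N ∧
    (∀ x, W x ≠ 0) ∧ (∀ x, N x ≠ 0) ∧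
    IsInvariant ξ W ∧ IsInvariant ξ N ∧
    (∀ x, W x ∈ S x) ∧ (∀ x, N x ∈ ltr g ξ S x) ∧
    (∀ x, VectorField.mlieBracket 𝓘(ℝ, E) W N x = 0) ∧
    (∀ x, 0 < g.val x (W x) (W x)) ∧
    (∀ x, g.val x (ξ x) (N x) = 1) ∧
    ∀ f : M → ℝ, IsBasicFunction (lineDistribution ξ) f →
      ∃ a b : M → ℝ, IsBasicFunction (lineDistribution ξ) a ∧
        IsBasicFunction (lineDistribution ξ) b ∧
        ∀ x, mvfderiv 𝓘(ℝ, E) b x (N x) - mvfderiv 𝓘(ℝ, E) a x (W x) = f x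

end Metric

end LightlikeFlow

end

/-!
The fields `ξ, W, N` of a complemented lightlike field commute pairwise, and they form a frame
(`linearIndependent_of_screen_of_ltr`): the metric pairs `ξ` nontrivially only with `N`, and
pairs `W` trivially with `ξ` and `N` but not with itself.

On commuting fields the invariant formula for the exterior derivative has no bracket terms
(`extD_apply_of_commute`). Let `η` be a closed basic `2`-form. Evaluating `dη = 0` on `ξ, W, N`
gives `ξ(η(W, N)) = 0`, because `η` vanishes on `ξ`. So `η(W, N)` is a basic function
(`isBasicFunction_apply_frame`), and it is `N(b) - W(a)` for some basic functions `a`, `b`. Let `α`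
be the `1`-form with `α(ξ) = 0`, `α(W) = -b`, `α(N) = -a` (`exists_oneForm_apply_frame`). Then
`dα(W, N) = W(α(N)) - N(α(W)) = η(W, N)`, and `dα(ξ, W) = dα(ξ, N) = 0` because `a`, `b` are basic.
So `dα = η`, and `α` is basic (`subsingleton_basicCohomology_two_of_frame`).

The exterior derivative, the bracket and smoothness of forms are all defined through the preferred
charts. A vector field `X` is therefore replaced by its expression `chartField X x₀` in the chart
at `x₀`, where the corresponding facts on vector spaces apply. At the centre of its own preferred
chart the derivative of the chart is the identity, so no change of coordinates is left in the
pointwise formulas.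
-/

namespace LightlikeFlow

open VectorField

/-! ### Smoothness of fields of alternating forms on a vector space -/

section Local

variable {E : Type*} [NormedAddCommGroup E] [NormedSpace ℝ E]

theorem contDiffOn_alternating_apply {k : ℕ} {β : E → E [⋀^Fin k]→L[ℝ] ℝ} {Y : Fin k → E → E}
    {s : Set E} (hβ : ContDiffOn ℝ ∞ β s) (hY : ∀ i, ContDiffOn ℝ ∞ (Y i) s) :
    ContDiffOn ℝ ∞ (fun y => β y (fun i => Y i y)) s := by
  -- Evaluation is jointly analytic in the alternating map and its arguments.
  have h := (ContinuousLinearMap.analyticOnNhd_uncurry_of_multilinear (s := univ)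
    (ContinuousAlternatingMap.toContinuousMultilinearMapCLM ℝ (E := E) (ι := Fin k) (F := ℝ)
      (𝕜 := ℝ))).contDiff (n := ∞)
  exact h.comp_contDiffOn (hβ.prodMk (contDiffOn_pi.2 hY))

/-- A field of `1`-forms is determined by its values on a frame through the inverse of the frame,
seen as an isomorphism `(ι → ℝ) ≃ E`; so it is smooth when these values and the frame are. -/
theorem contDiffOn_oneForm_of_frame [FiniteDimensional ℝ E] {ι : Type*} [Fintype ι]
    {β : E → E [⋀^Fin 1]→L[ℝ] ℝ} {Y : ι → E → E} {s : Set E}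
    (hcard : Fintype.card ι = Module.finrank ℝ E)
    (hY : ∀ i, ContDiffOn ℝ ∞ (Y i) s) (hli : ∀ y ∈ s, LinearIndependent ℝ (fun i => Y i y))
    (hβ : ∀ i, ContDiffOn ℝ ∞ (fun y => β y (fun _ => Y i y)) s) : ContDiffOn ℝ ∞ β s := by
  classical
  -- `A y` is the frame at `y`, and `B y` is `β y` in this frame, so that `β y = B y ∘ (A y)⁻¹`.
  let A : E → (ι → ℝ) →L[ℝ] E := fun y =>
    ∑ i, (ContinuousLinearMap.proj i : (ι → ℝ) →L[ℝ] ℝ).smulRight (Y i y)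
  let B : E → (ι → ℝ) →L[ℝ] ℝ := fun y =>
    ∑ i, (ContinuousLinearMap.proj i : (ι → ℝ) →L[ℝ] ℝ).smulRight (β y (fun _ => Y i y))
  have hA : ContDiffOn ℝ ∞ A s := ContDiffOn.sum fun i _ => contDiffOn_const.smulRight (hY i)
  have hB : ContDiffOn ℝ ∞ B s := ContDiffOn.sum fun i _ => contDiffOn_const.smulRight (hβ i)
  have key : ∀ y ∈ s, ∃ e : (ι → ℝ) ≃L[ℝ] E, (e : (ι → ℝ) →L[ℝ] E) = A y := by
    intro y hy
    let b := basisOfLinearIndependentOfCardEqFinrank' _ (hli y hy) hcard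
    refine ⟨b.equivFun.symm.toContinuousLinearEquiv, ?_⟩
    ext1 c
    simp [A, b, Module.Basis.equivFun_symm_apply]
  have hinv : ContDiffOn ℝ ∞ (fun y => (A y).inverse) s := by
    intro y hy
    obtain ⟨e, he⟩ := key y hy
    have h := contDiffAt_map_inverse (𝕜 := ℝ) (n := ∞) e
    rw [he] at h
    exact h.comp_contDiffWithinAt y (hA y hy)
  have hL := (ContinuousAlternatingMap.ofSubsingletonLIE (𝕜 := ℝ) (E := E) (F := ℝ)
    (0 : Fin 1)).toContinuousLinearEquiv.contDiff.comp_contDiffOn (hB.clm_comp hinv)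
  refine hL.congr fun y hy => ?_
  obtain ⟨e, he⟩ := key y hy
  ext v
  obtain ⟨c, hc⟩ := e.surjective (v 0)
  have hv : v = fun _ => ∑ i, c i • Y i y := by
    funext j
    rw [Subsingleton.elim j 0, ← hc, ← ContinuousLinearEquiv.coe_coe, he]
    simp [A]
  have hlin : β y v = ∑ i, c i * β y (fun _ => Y i y) := by
    let ℓ := (ContinuousAlternatingMap.ofSubsingleton ℝ E ℝ (0 : Fin 1)).symm (β y)
    have hℓ : ∀ w, β y (fun _ => w) = ℓ w := fun w => by
      have := congrArg (fun γ => γ (fun _ => w))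
        ((ContinuousAlternatingMap.ofSubsingleton ℝ E ℝ (0 : Fin 1)).apply_symm_apply (β y))
      exact this.symm
    rw [hv]
    simp only [hℓ, map_sum, map_smul, smul_eq_mul]
  rw [hlin]
  change _ = B y ((A y).inverse (v 0))
  rw [← he, ContinuousLinearMap.inverse_equiv, ← hc]
  simp [B]

end Local

/-! ### Vector fields and forms in charts -/

section Charts

variable {E : Type*} [NormedAddCommGroup E] [NormedSpace ℝ E]
variable {M : Type*} [TopologicalSpace M] [ChartedSpace E M]

/-- The expression of a vector field in the preferred chart `φ` at `x₀`, i.e. its pullback under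
`φ⁻¹`. It is meaningful on the target of `φ`. -/
noncomputable def chartField (X : ∀ x : M, TangentSpace 𝓘(ℝ, E) x) (x₀ : M) : E → E :=
  mpullback 𝓘(ℝ, E) 𝓘(ℝ, E) (extChartAt 𝓘(ℝ, E) x₀).symm X

theorem mvfderiv_eq_fderiv {f : M → ℝ} (hf : ContMDiff 𝓘(ℝ, E) 𝓘(ℝ, ℝ) ∞ f) (x : M) :
    mvfderiv 𝓘(ℝ, E) f x =
      fderiv ℝ (f ∘ (extChartAt 𝓘(ℝ, E) x).symm) (extChartAt 𝓘(ℝ, E) x x) := by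
  rw [((hf x).mdifferentiableAt (by simp)).mvfderiv, modelWithCornersSelf_coe, range_id,
    fderivWithin_univ]
  rfl

variable [IsManifold 𝓘(ℝ, E) ∞ M]

theorem isInvertible_mfderiv_symm {x₀ : M} {y : E} (hy : y ∈ (extChartAt 𝓘(ℝ, E) x₀).target) :
    (mfderiv 𝓘(ℝ, E) 𝓘(ℝ, E) (extChartAt 𝓘(ℝ, E) x₀).symm y).IsInvertible := by
  have := IsManifold.of_le (I := 𝓘(ℝ, E)) (M := M) (n := ∞) (m := 1) (by simp)
  have h := isInvertible_mfderivWithin_extChartAt_symm (I := 𝓘(ℝ, E)) hy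
  rwa [modelWithCornersSelf_coe, range_id, mfderivWithin_univ] at h

theorem mfderiv_symm_chartField (X : ∀ x : M, TangentSpace 𝓘(ℝ, E) x) {x₀ : M} {y : E}
    (hy : y ∈ (extChartAt 𝓘(ℝ, E) x₀).target) :
    mfderiv 𝓘(ℝ, E) 𝓘(ℝ, E) (extChartAt 𝓘(ℝ, E) x₀).symm y (chartField (E := E) X x₀ y) =
      X ((extChartAt 𝓘(ℝ, E) x₀).symm y) := by
  obtain ⟨e, he⟩ := isInvertible_mfderiv_symm (M := M) hy
  rw [chartField, mpullback_apply, ← he, ContinuousLinearMap.inverse_equiv]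
  exact e.apply_symm_apply _

theorem chartForm_chartField {k : ℕ} (α : Form E M k)
    (X : Fin k → ∀ x : M, TangentSpace 𝓘(ℝ, E) x) {x₀ : M} {y : E}
    (hy : y ∈ (extChartAt 𝓘(ℝ, E) x₀).target) :
    chartForm α x₀ y (fun i => chartField (X i) x₀ y) =
      α ((extChartAt 𝓘(ℝ, E) x₀).symm y) (fun i => X i ((extChartAt 𝓘(ℝ, E) x₀).symm y)) := by
  refine congrArg (α _) (funext fun i => ?_)
  exact mfderiv_symm_chartField (X i) hy

/-- In the preferred chart at `x` the derivative of the chart at `x` is the identity, so that a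
field and its expression have the same value. -/
theorem chartField_self (X : ∀ x : M, TangentSpace 𝓘(ℝ, E) x) (x : M) :
    chartField X x (extChartAt 𝓘(ℝ, E) x x) = X x := by
  have := IsManifold.of_le (I := 𝓘(ℝ, E)) (M := M) (n := ∞) (m := 1) (by simp)
  have h := mfderivWithin_extChartAt_symm_inverse_apply (I := 𝓘(ℝ, E))
    (X ((extChartAt 𝓘(ℝ, E) x).symm (extChartAt 𝓘(ℝ, E) x x)) : E) (x := x)
  rw [modelWithCornersSelf_coe, range_id, mfderivWithin_univ] at h
  refine h.trans ?_
  rw [extChartAt_to_inv]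

theorem IsSmoothField.contDiffOn_chartField [CompleteSpace E]
    {X : ∀ x : M, TangentSpace 𝓘(ℝ, E) x} (hX : IsSmoothField X) (x₀ : M) :
    ContDiffOn ℝ ∞ (chartField X x₀) (extChartAt 𝓘(ℝ, E) x₀).target := by
  intro y hy
  have hsymm : ContMDiffAt 𝓘(ℝ, E) 𝓘(ℝ, E) ∞ (extChartAt 𝓘(ℝ, E) x₀).symm y :=
    (contMDiffOn_extChartAt_symm x₀).contMDiffAt ((isOpen_extChartAt_target x₀).mem_nhds hy)
  have h := ContMDiffWithinAt.mpullback_vectorField_preimage (t := univ) (n := ∞)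
    (hX _).contMDiffWithinAt hsymm (isInvertible_mfderiv_symm hy) (by simp)
  rw [preimage_univ, contMDiffWithinAt_univ] at h
  have h2 := ((contMDiff_snd_tangentBundle_modelSpace E 𝓘(ℝ, E)).contMDiffAt).comp y h
  exact (contMDiffAt_iff_contDiffAt.1 h2).contDiffWithinAt

theorem lieBracket_chartField_eq_zero {X Y : ∀ x : M, TangentSpace 𝓘(ℝ, E) x} {x : M}
    (h : mlieBracket 𝓘(ℝ, E) X Y x = 0) :
    lieBracket ℝ (chartField X x) (chartField Y x) (extChartAt 𝓘(ℝ, E) x x) = 0 := by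
  have := IsManifold.of_le (I := 𝓘(ℝ, E)) (M := M) (n := ∞) (m := 1) (by simp)
  rw [mlieBracket, mlieBracketWithin_apply, modelWithCornersSelf_coe, range_id, preimage_univ,
    univ_inter, mpullbackWithin_univ, mpullbackWithin_univ] at h
  -- Stated for endomorphisms of `E`, to which the tangent spaces at `x` and at its image reduce.
  have hinv : ∀ L : E →L[ℝ] E, L = ContinuousLinearMap.id ℝ E →
      L.inverse = ContinuousLinearMap.id ℝ E := by
    rintro _ rfl
    exact ContinuousLinearMap.inverse_id
  rw [← lieBracketWithin_univ]
  exact (DFunLike.congr_fun (hinv _ mfderiv_extChartAt_self) _).symm.trans h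

/-- The linear map by which `extD` pulls back from the chart is the identity. -/
theorem extD_apply {k : ℕ} (α : Form E M k) (x : M)
    (v : Fin (k + 1) → TangentSpace 𝓘(ℝ, E) x) :
    extD α x v = extDeriv (chartForm α x) (extChartAt 𝓘(ℝ, E) x x) v := by
  have := IsManifold.of_le (I := 𝓘(ℝ, E)) (M := M) (n := ∞) (m := 1) (by simp)
  rw [extD, mfderiv_extChartAt_self]
  rfl

/-- Smoothness of a function is tested on the targets of the preferred charts, as for forms. -/
theorem contMDiff_iff_chart {f : M → ℝ} : ContMDiff 𝓘(ℝ, E) 𝓘(ℝ, ℝ) ∞ f ↔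
    ∀ x₀ : M, ContDiffOn ℝ ∞ (f ∘ (extChartAt 𝓘(ℝ, E) x₀).symm)
      (extChartAt 𝓘(ℝ, E) x₀).target := by
  refine ⟨fun hf x₀ => contMDiffOn_iff_contDiffOn.1
    (hf.comp_contMDiffOn (contMDiffOn_extChartAt_symm x₀)), fun h x => ?_⟩
  have h1 : ContMDiffAt 𝓘(ℝ, E) 𝓘(ℝ, ℝ) ∞ (f ∘ (extChartAt 𝓘(ℝ, E) x).symm)
      (extChartAt 𝓘(ℝ, E) x x) :=
    (contMDiffOn_iff_contDiffOn.2 (h x)).contMDiffAt (extChartAt_target_mem_nhds x)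
  refine (h1.comp x (contMDiffAt_extChartAt)).congr_of_eventuallyEq ?_
  filter_upwards [extChartAt_source_mem_nhds (I := 𝓘(ℝ, E)) x] with y hy
  simp only [Function.comp_apply, (extChartAt 𝓘(ℝ, E) x).left_inv hy]

theorem IsSmoothForm.contMDiff_apply [CompleteSpace E] {k : ℕ} {α : Form E M k}
    (hα : IsSmoothForm α) {X : Fin k → ∀ x : M, TangentSpace 𝓘(ℝ, E) x}
    (hX : ∀ i, IsSmoothField (X i)) :
    ContMDiff 𝓘(ℝ, E) 𝓘(ℝ, ℝ) ∞ (fun x => α x (fun i => X i x)) := by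
  refine contMDiff_iff_chart.2 fun x₀ => ?_
  refine (contDiffOn_alternating_apply (hα x₀)
    (fun i => (hX i).contDiffOn_chartField x₀)).congr fun y hy => ?_
  exact (chartForm_chartField α X hy).symm

/-- A `1`-form is smooth as soon as its values on a smooth frame are smooth functions. -/
theorem isSmoothForm_one_of_frame [FiniteDimensional ℝ E] {ι : Type*} [Fintype ι]
    {α : Form E M 1} {V : ι → ∀ x : M, TangentSpace 𝓘(ℝ, E) x}
    (hcard : Fintype.card ι = Module.finrank ℝ E) (hV : ∀ i, IsSmoothField (V i))
    (hli : ∀ x, LinearIndependent ℝ (fun i => V i x))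
    (hα : ∀ i, ContMDiff 𝓘(ℝ, E) 𝓘(ℝ, ℝ) ∞ (fun x => α x (fun _ => V i x))) :
    IsSmoothForm α := by
  have := FiniteDimensional.complete ℝ E
  intro x₀
  refine contDiffOn_oneForm_of_frame (Y := fun i => chartField (V i) x₀) hcard
    (fun i => (hV i).contDiffOn_chartField x₀) (fun y hy => ?_) fun i => ?_
  · refine LinearIndependent.of_comp (mfderiv 𝓘(ℝ, E) 𝓘(ℝ, E)
      (extChartAt 𝓘(ℝ, E) x₀).symm y).toLinearMap ?_
    convert hli ((extChartAt 𝓘(ℝ, E) x₀).symm y) using 2 with i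
    exact mfderiv_symm_chartField (V i) hy
  · exact (contMDiff_iff_chart.1 (hα i) x₀).congr fun y hy =>
      chartForm_chartField α (fun _ => V i) hy

/-- The invariant formula for the exterior derivative on commuting vector fields, where the terms
with brackets vanish. -/
theorem extD_apply_of_commute [CompleteSpace E] {k : ℕ} {α : Form E M k} (hα : IsSmoothForm α)
    {X : Fin (k + 1) → ∀ x : M, TangentSpace 𝓘(ℝ, E) x} (hX : ∀ i, IsSmoothField (X i)) {x : M}
    (hcomm : Pairwise fun i j => mlieBracket 𝓘(ℝ, E) (X i) (X j) x = 0) :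
    extD α x (fun i => X i x) = ∑ i : Fin (k + 1), (-1) ^ i.val •
      mvfderiv 𝓘(ℝ, E) (fun y => α y (fun j => X (i.succAbove j) y)) x (X i x) := by
  have ht := extChartAt_target_mem_nhds (I := 𝓘(ℝ, E)) x
  have h := extDeriv_apply_vectorField_of_pairwise_commute
    (V := fun i => chartField (X i) x) (hα.differentiableAt x)
    (fun i => (((hX i).contDiffOn_chartField x).contDiffAt ht).differentiableAt (by simp))
    (fun i j hij => lieBracket_chartField_eq_zero (hcomm hij))
  simp only [chartField_self] at h
  rw [extD_apply]
  refine h.trans (Finset.sum_congr rfl fun i _ => ?_)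
  rw [mvfderiv_eq_fderiv (hα.contMDiff_apply fun j => hX _)]
  refine congrArg (fun L : E →L[ℝ] ℝ => (-1) ^ i.val • L (X i x)) ?_
  refine Filter.EventuallyEq.fderiv_eq ?_
  filter_upwards [ht] with y hy
  exact chartForm_chartField α (fun j => X (i.succAbove j)) hy

/-- A `1`-form with prescribed smooth values on a smooth frame. -/
theorem exists_oneForm_apply_frame [FiniteDimensional ℝ E] {ι : Type*} [Fintype ι]
    {V : ι → ∀ x : M, TangentSpace 𝓘(ℝ, E) x} (hcard : Fintype.card ι = Module.finrank ℝ E)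
    (hV : ∀ i, IsSmoothField (V i)) (hli : ∀ x, LinearIndependent ℝ (fun i => V i x))
    {u : ι → M → ℝ} (hu : ∀ i, ContMDiff 𝓘(ℝ, E) 𝓘(ℝ, ℝ) ∞ (u i)) :
    ∃ α : Form E M 1, IsSmoothForm α ∧ ∀ i x, α x (fun _ => V i x) = u i x := by
  let b : ∀ x : M, Module.Basis ι ℝ E := fun x =>
    basisOfLinearIndependentOfCardEqFinrank' (V := E) (fun i => V i x) (hli x) hcard
  let α : Form E M 1 := fun x => ContinuousAlternatingMap.ofSubsingleton ℝ E ℝ (0 : Fin 1)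
    (LinearMap.toContinuousLinearMap ((b x).constr ℝ (fun i => u i x)))
  have hα : ∀ i x, α x (fun _ => V i x) = u i x := by
    intro i x
    have hb : b x i = V i x := congrFun (coe_basisOfLinearIndependentOfCardEqFinrank' _ _ _) i
    have h : (b x).constr ℝ (fun i => u i x) (b x i) = u i x := (b x).constr_basis ..
    rw [hb] at h
    exact h
  exact ⟨α, isSmoothForm_one_of_frame hcard hV hli fun i => by simpa only [hα] using hu i, hα⟩

end Charts

/-! ### Basic cohomology of a flow in a commuting frame -/

section Cohomology

variable {E : Type*} [NormedAddCommGroup E] [NormedSpace ℝ E]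
variable {M : Type*} [TopologicalSpace M] [ChartedSpace E M] [IsManifold 𝓘(ℝ, E) ∞ M]

/-- Evaluated on `V 0, V 1, V 2`, the equation `dη = 0` reads `V 0 (η(V 1, V 2)) = 0`, since the
other two terms of the invariant formula differentiate the zero function. -/
theorem isBasicFunction_apply_frame [CompleteSpace E]
    {V : Fin 3 → ∀ x : M, TangentSpace 𝓘(ℝ, E) x} (hV : ∀ i, IsSmoothField (V i))
    (hcomm : ∀ x, Pairwise fun i j => mlieBracket 𝓘(ℝ, E) (V i) (V j) x = 0)
    {η : Form E M 2} (hη : IsSmoothForm η) (hann : Annihilates (lineDistribution (V 0)) η)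
    (hclosed : extD η = 0) :
    IsBasicFunction (lineDistribution (V 0)) (fun x => η x (fun j => V j.succ x)) := by
  refine ⟨hη.contMDiff_apply fun j => hV _, fun x v hv => ?_⟩
  obtain ⟨c, rfl⟩ := Submodule.mem_span_singleton.1 hv
  have hzero : ∀ i : Fin 3, i ≠ 0 →
      (fun y => η y (fun j => V (i.succAbove j) y)) = (0 : M → ℝ) := fun i hi => by
    funext y
    refine hann y _ ⟨0, ?_⟩
    rw [Fin.succAbove_ne_zero_zero hi]
    exact Submodule.mem_span_singleton_self _
  have h := extD_apply_of_commute hη hV (hcomm x)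
  rw [hclosed, Fin.sum_univ_succ, Finset.sum_eq_zero fun i _ => by
    rw [hzero _ (Fin.succ_ne_zero i), mvfderiv_zero]; simp] at h
  have h0 : mvfderiv 𝓘(ℝ, E) (fun y => η y (fun j => V j.succ y)) x (V 0 x) = 0 := by
    simpa using h.symm
  rw [map_smul, h0, smul_zero]

/-- Vanishing of the second basic cohomology of the flow of `V 0`, when `V 0` is part of a
commuting frame `V 0, V 1, V 2` and every basic function is of the form `V 2 (b) - V 1 (a)`. -/
theorem subsingleton_basicCohomology_two_of_frame [FiniteDimensional ℝ E]
    (hE : Module.finrank ℝ E = 3)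
    {V : Fin 3 → ∀ x : M, TangentSpace 𝓘(ℝ, E) x} (hV : ∀ i, IsSmoothField (V i))
    (hli : ∀ x, LinearIndependent ℝ (fun i => V i x))
    (hcomm : ∀ x, Pairwise fun i j => mlieBracket 𝓘(ℝ, E) (V i) (V j) x = 0)
    (hsolve : ∀ f : M → ℝ, IsBasicFunction (lineDistribution (V 0)) f →
      ∃ a b : M → ℝ, IsBasicFunction (lineDistribution (V 0)) a ∧
        IsBasicFunction (lineDistribution (V 0)) b ∧
        ∀ x, mvfderiv 𝓘(ℝ, E) b x (V 2 x) - mvfderiv 𝓘(ℝ, E) a x (V 1 x) = f x) :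
    Subsingleton (BasicCohomology (lineDistribution (V 0)) 2) := by
  have := FiniteDimensional.complete ℝ E
  have hcard : Fintype.card (Fin 3) = Module.finrank ℝ E := by simp [hE]
  rw [Submodule.Quotient.subsingleton_iff, eq_top_iff]
  rintro ⟨_, ⟨⟨η, hη, hann, -⟩, hker, rfl⟩⟩ -
  change η ∈ LinearMap.range (basicD (lineDistribution (V 0)) 1)
  have hclosed : extD η = 0 := hker
  obtain ⟨a, b, ha, hb, hab⟩ := hsolve _ (isBasicFunction_apply_frame hV hcomm hη hann hclosed)
  -- The values of `α` on the frame are chosen so that `dα(V 1, V 2) = V 1 (-a) - V 2 (-b)`.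
  let u : Fin 3 → M → ℝ := ![0, -b, -a]
  have hu : ∀ i, ContMDiff 𝓘(ℝ, E) 𝓘(ℝ, ℝ) ∞ (u i) := by
    intro i
    fin_cases i
    exacts [contMDiff_const, hb.1.neg, ha.1.neg]
  obtain ⟨α, hα, hαV⟩ := exists_oneForm_apply_frame hcard hV hli hu
  have hd : ∀ x (p : Fin 2 → Fin 3), Function.Injective p →
      extD α x (fun j => V (p j) x) = mvfderiv 𝓘(ℝ, E) (u (p 1)) x (V (p 0) x) -
        mvfderiv 𝓘(ℝ, E) (u (p 0)) x (V (p 1) x) := by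
    intro x p hp
    have hval : ∀ i : Fin 2, (fun y => α y (fun j => V (p (i.succAbove j)) y)) =
        u (p (i.succAbove 0)) := fun i => by
      funext y
      rw [← hαV]
      congr 1
      funext j
      rw [Subsingleton.elim j 0]
    rw [extD_apply_of_commute hα (X := fun j => V (p j)) (fun j => hV _)
      (fun i j hij => hcomm x (hp.ne hij))]
    simp only [hval]
    simp [sub_eq_add_neg]
  have hu0 : ∀ x, mvfderiv 𝓘(ℝ, E) (u 0) x = 0 := fun x => mvfderiv_zero
  have hV0 : ∀ i x, mvfderiv 𝓘(ℝ, E) (u i) x (V 0 x) = 0 := by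
    have hmem : ∀ x, V 0 x ∈ lineDistribution (V 0) x := fun x =>
      Submodule.mem_span_singleton_self _
    intro i x
    fin_cases i
    · exact DFunLike.congr_fun (hu0 x) _
    · change mvfderiv 𝓘(ℝ, E) (-b) x (V 0 x) = 0
      rw [mvfderiv_neg, neg_apply, hb.2 x _ (hmem x), neg_zero]
    · change mvfderiv 𝓘(ℝ, E) (-a) x (V 0 x) = 0
      rw [mvfderiv_neg, neg_apply, ha.2 x _ (hmem x), neg_zero]
  have h12 : ∀ x, mvfderiv 𝓘(ℝ, E) (u 2) x (V 1 x) - mvfderiv 𝓘(ℝ, E) (u 1) x (V 2 x) =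
      η x ![V 1 x, V 2 x] := by
    intro x
    have hη12 : η x (fun j => V j.succ x) = η x ![V 1 x, V 2 x] :=
      congrArg (η x) (funext fun j => by fin_cases j <;> rfl)
    change mvfderiv 𝓘(ℝ, E) (-a) x (V 1 x) - mvfderiv 𝓘(ℝ, E) (-b) x (V 2 x) = _
    rw [← hη12, ← hab x, mvfderiv_neg, mvfderiv_neg, neg_apply, neg_apply]
    ring
  have hswap : ∀ x, η x ![V 2 x, V 1 x] = -η x ![V 1 x, V 2 x] := by
    intro x
    refine Eq.trans (congrArg (η x) (funext fun j => ?_))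
      ((η x).toAlternatingMap.map_swap ![V 1 x, V 2 x] (i := 0) (j := 1) (by decide))
    fin_cases j <;> rfl
  have hdα : extD α = η := by
    funext x
    let e : Module.Basis (Fin 3) ℝ E :=
      basisOfLinearIndependentOfCardEqFinrank' (V := E) (fun i => V i x) (hli x) hcard
    have he : ∀ i, e i = V i x := fun i =>
      congrFun (coe_basisOfLinearIndependentOfCardEqFinrank' _ _ _) i
    refine ContinuousAlternatingMap.toAlternatingMap_injective
      (Module.Basis.ext_alternating e fun p hp => ?_)
    have hep : (fun j => e (p j)) = fun j => V (p j) x := funext fun j => he (p j)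
    suffices h : extD α x (fun j => V (p j) x) = η x (fun j => V (p j) x) from
      (congrArg (extD α x) hep).trans (h.trans (congrArg (η x) hep).symm)
    -- On pairs containing `V 0` both sides vanish; the pairs `(1, 2)` and `(2, 1)` remain.
    rw [hd x p hp]
    by_cases h0 : p 0 = 0
    · rw [hann x _ ⟨0, by rw [h0]; exact Submodule.mem_span_singleton_self _⟩, h0, hu0, hV0]
      simp
    by_cases h1 : p 1 = 0
    · rw [hann x _ ⟨1, by rw [h1]; exact Submodule.mem_span_singleton_self _⟩, h1, hu0, hV0]
      simp
    have hp01 : p 0 ≠ p 1 := hp.ne (by decide)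
    have hcases : (p 0 = 1 ∧ p 1 = 2) ∨ (p 0 = 2 ∧ p 1 = 1) := by omega
    have hvec : (fun j => V (p j) x) = ![V (p 0) x, V (p 1) x] :=
      funext fun j => by fin_cases j <;> rfl
    rw [hvec]
    rcases hcases with ⟨hp0, hp1⟩ | ⟨hp0, hp1⟩
    · rw [hp0, hp1, h12]
    · rw [hp0, hp1, hswap, ← h12, neg_sub]
  refine ⟨⟨α, hα, ?_, hdα ▸ hann⟩, hdα⟩
  rintro x v ⟨i, hi⟩
  obtain ⟨c, hc⟩ := Submodule.mem_span_singleton.1 hi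
  have hv : v = fun _ => c • V 0 x := funext fun j => by rw [hc, Subsingleton.elim j i]
  rw [hv]
  have hs := (α x).map_update_smul (fun _ => V 0 x) 0 c (V 0 x)
  have hupd : ∀ w, Function.update (fun _ : Fin 1 => V 0 x) 0 w = fun _ => w := fun w =>
    funext fun j => by rw [Subsingleton.elim j 0, Function.update_self]
  rw [hupd, hupd, hαV] at hs
  exact hs.trans (smul_zero c)

end Cohomology

/-! ### The frame of a complemented lightlike field -/

section Frame

variable {E : Type*} [NormedAddCommGroup E] [NormedSpace ℝ E]
variable {M : Type*} [TopologicalSpace M] [ChartedSpace E M] [IsManifold 𝓘(ℝ, E) ∞ M]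

/-- With respect to `ξ, W, N` the matrix of `g` has zero entries at `(ξ, ξ)`, `(ξ, W)` and `(W, N)`,
the last two because `S` lies in `ξ^⊥` and `ltr` in `S^⊥`; the other relevant entries are nonzero. -/
theorem linearIndependent_of_screen_of_ltr (g : SemiRiemannianMetric E M)
    {ξ W N : ∀ x : M, TangentSpace 𝓘(ℝ, E) x} {S : Distribution E M} {x : M}
    (hnull : g.val x (ξ x) (ξ x) = 0) (hS : IsScreen g (lineDistribution ξ) S)
    (hW : W x ∈ S x) (hN : N x ∈ ltr g ξ S x) (hWW : 0 < g.val x (W x) (W x))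
    (hξN : g.val x (ξ x) (N x) = 1) : LinearIndependent ℝ ![ξ x, W x, N x] := by
  have hWξ : g.val x (W x) (ξ x) = 0 := by
    have h : W x ∈ orth g (lineDistribution ξ) x := by
      rw [← (hS.2 x).2]
      exact Submodule.mem_sup_left hW
    exact h _ (Submodule.mem_span_singleton_self _)
  have hWN : g.val x (W x) (N x) = 0 := by
    have hle : ltr g ξ S x ≤ orth g S x := Submodule.span_le.2 fun v hv => hv.1
    rw [g.symm]
    exact hle hN _ hW
  rw [Fintype.linearIndependent_iff]
  intro c hc
  have hsum : c 0 • ξ x + c 1 • W x + c 2 • N x = 0 := by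
    simpa [Fin.sum_univ_succ, add_assoc] using hc
  have hpair : ∀ v : TangentSpace 𝓘(ℝ, E) x,
      c 0 * g.val x v (ξ x) + c 1 * g.val x v (W x) + c 2 * g.val x v (N x) = 0 := by
    intro v
    have h := congrArg (fun w => g.val x v w) hsum
    simpa only [map_add, map_smul, smul_eq_mul, map_zero] using h
  -- Pair with `ξ` for the coefficient of `N`, with `W` for that of `W`, with `N` for that of `ξ`.
  have h2 : c 2 = 0 := by
    have h := hpair (ξ x)
    rw [hnull, g.symm x (ξ x) (W x), hWξ, hξN] at h
    linarith
  have h1 : c 1 = 0 := by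
    have h := hpair (W x)
    rw [hWξ, hWN, mul_zero, mul_zero, zero_add, add_zero] at h
    exact (mul_eq_zero.1 h).resolve_right hWW.ne'
  have h0 : c 0 = 0 := by
    have h := hpair (N x)
    rw [h1, h2, g.symm x (N x) (ξ x), hξN] at h
    linarith
  intro i
  fin_cases i
  exacts [h0, h1, h2]

end Frame

end LightlikeFlow

theorem mainTheorem6 {M : Type*} [TopologicalSpace M]
    [ChartedSpace (EuclideanSpace ℝ (Fin 3)) M]
    [IsManifold 𝓘(ℝ, EuclideanSpace ℝ (Fin 3)) ∞ M] [T2Space M] [SecondCountableTopology M]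
    (g : LightlikeFlow.SemiRiemannianMetric (EuclideanSpace ℝ (Fin 3)) M)
    (ξ : ∀ x : M, TangentSpace 𝓘(ℝ, EuclideanSpace ℝ (Fin 3)) x)
    (hξ : LightlikeFlow.IsSmoothField ξ)
    (hnull : LightlikeFlow.IsLightlike g ξ)
    (hkilling : LightlikeFlow.IsKilling g ξ)
    (hcompl : LightlikeFlow.IsComplemented g ξ) :
    Subsingleton
      (LightlikeFlow.BasicCohomology (LightlikeFlow.lineDistribution ξ) 2) := by
  obtain ⟨S, W, N, hS, hW, hN, -, -, hξW, hξN, hWS, hNltr, hWN, hWW, hg, hsolve⟩ := hcompl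
  refine LightlikeFlow.subsingleton_basicCohomology_two_of_frame (V := ![ξ, W, N]) (by simp)
    (fun i => ?_) (fun x => ?_) (fun x i j hij => ?_) hsolve
  · fin_cases i
    exacts [hξ, hW, hN]
  · convert LightlikeFlow.linearIndependent_of_screen_of_ltr g (hnull x).2 hS (hWS x) (hNltr x)
      (hWW x) (hg x) using 2 with i
    fin_cases i <;> rfl
  · have hsymm : ∀ X Y : ∀ x : M, TangentSpace 𝓘(ℝ, EuclideanSpace ℝ (Fin 3)) x,
        VectorField.mlieBracket 𝓘(ℝ, EuclideanSpace ℝ (Fin 3)) X Y x = 0 →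
        VectorField.mlieBracket 𝓘(ℝ, EuclideanSpace ℝ (Fin 3)) Y X x = 0 := fun X Y h => by
      rw [VectorField.mlieBracket_swap_apply, h, neg_zero]
    fin_cases i <;> fin_cases j
    exacts [absurd rfl hij, hξW x, hξN x, hsymm _ _ (hξW x), absurd rfl hij, hWN x,
      hsymm _ _ (hξN x), hsymm _ _ (hWN x), absurd rfl hij]
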